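/- Let $s\ge 2$ and let $d_1,\dots,d_s>1$ be integers with product $d=d_1\cdots d_s$. For a prime $p$ put $A=(\mathbb{Z}/p)[x_1,\dots,x_s]$ and $h=\sum_i x_i^{d_i}\in A$. For $n\ge 0$ and $q=p^n$ let $e_n$ be the length of $A/(h,x_1^q,\dots,x_s^q)$, and for integers $k_1,\dots,k_s\ge 0$ let $D_p(k_1,\dots,k_s)$ be the length of $A/(\sum_i x_i,\,x_1^{k_1},\dots,x_s^{k_s})$. For each fixed $p$ the limit $\mu=\mu_p=\lim_{n\to\infty} e_n/q^{s-1}$ (the Hilbert-Kunz multiplicity of $h$) exists, and $e_n=\mu q^{s-1}+O(q^{s-2})$ as $n\to\infty$. Suppose that for each prime $p$ we are given integers $a_1,\dots,a_s\ge 0$ (depending on $p$) with $a_i=\frac{p}{d_i}+O(1)$, i.e. $|a_i-\frac{p}{d_i}|$ is bounded independently of $p$ and $i$. Then there is a constant $k$ such that for all primes $p$ $$\left|\,\mu_p-d\,p^{1-s}D_p(a_1,\dots,a_s)\right|\le\frac{k}{p}.$$ -/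

import Mathlib

open Filter Topology Asymptotics

namespace HilbertKunz

/-- The colength of an ideal `I`: the length of the `R`-module `R ⧸ I`, as a natural number.
It is used below only for ideals of finite colength, see `length_ne_top`. -/
noncomputable def colength {R : Type*} [CommRing R] (I : Ideal R) : ℕ :=
  (Module.length R (R ⧸ I)).toNat

/-- The ideal `(f, x_1 ^ k_1, …, x_s ^ k_s)` of `(ℤ/p)[x_1, …, x_s]`. -/
noncomputable def powIdeal {p s : ℕ} (f : MvPolynomial (Fin s) (ZMod p)) (k : Fin s → ℕ) :
    Ideal (MvPolynomial (Fin s) (ZMod p)) :=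
  Ideal.span (insert f (Set.range fun i => MvPolynomial.X i ^ k i))

/-- The ideals `powIdeal f k` have finite colength. -/
theorem length_ne_top {p s : ℕ} [Fact p.Prime] (f : MvPolynomial (Fin s) (ZMod p))
    (k : Fin s → ℕ) :
    Module.length (MvPolynomial (Fin s) (ZMod p))
      (MvPolynomial (Fin s) (ZMod p) ⧸ powIdeal f k) ≠ ⊤ := by
  set I := powIdeal f k with hI
  set g := Ideal.Quotient.mkₐ (ZMod p) I with hg
  have hfin : Module.Finite (ZMod p) (MvPolynomial (Fin s) (ZMod p) ⧸ I) := by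
    have hint : ∀ x ∈ Set.range (fun i => g (MvPolynomial.X i)), IsIntegral (ZMod p) x := by
      rintro _ ⟨i, rfl⟩
      have h0 : (g (MvPolynomial.X i)) ^ (k i + 1) = 0 := by
        rw [← map_pow, hg, Ideal.Quotient.mkₐ_eq_mk, Ideal.Quotient.eq_zero_iff_mem, pow_succ]
        exact I.mul_mem_right _ (Ideal.subset_span (Set.mem_insert_of_mem _ ⟨i, rfl⟩))
      refine IsIntegral.of_pow (Nat.succ_pos (k i)) ?_
      rw [h0]
      exact isIntegral_zero
    have hadj := Algebra.finite_adjoin_of_finite_of_isIntegral (Set.finite_range _) hint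
    have htop : Algebra.adjoin (ZMod p) (Set.range fun i => g (MvPolynomial.X i)) = ⊤ := by
      have h1 : (Set.range fun i => g (MvPolynomial.X i)) = g '' Set.range MvPolynomial.X := by
        rw [← Set.range_comp]; rfl
      rw [h1, Algebra.adjoin_image, MvPolynomial.adjoin_range_X, Algebra.map_top,
        AlgHom.range_eq_top]
      exact Ideal.Quotient.mkₐ_surjective _ _
    rw [htop] at hadj
    exact Module.Finite.equiv (Subalgebra.topEquiv (R := ZMod p)).toLinearEquiv
  have : IsArtinian (MvPolynomial (Fin s) (ZMod p)) (MvPolynomial (Fin s) (ZMod p) ⧸ I) :=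
    isArtinian_of_tower (ZMod p) inferInstance
  have : IsNoetherian (MvPolynomial (Fin s) (ZMod p)) (MvPolynomial (Fin s) (ZMod p) ⧸ I) :=
    isNoetherian_of_tower (ZMod p) inferInstance
  exact Module.length_ne_top

/-- `D_p(k_1, …, k_s)`, the length of `(ℤ/p)[x_1, …, x_s] / (∑ x_i, x_1 ^ k_1, …, x_s ^ k_s)`. -/
noncomputable def D (p : ℕ) {s : ℕ} (k : Fin s → ℕ) : ℕ :=
  colength (powIdeal (p := p) (∑ i, MvPolynomial.X i) k)

/-- The diagonal hypersurface `h = ∑ x_i ^ d_i` over `ℤ/p`. -/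
noncomputable def diagonal (p : ℕ) {s : ℕ} (d : Fin s → ℕ) : MvPolynomial (Fin s) (ZMod p) :=
  ∑ i, MvPolynomial.X i ^ d i

/-- `e_n(f)`, the colength of the ideal generated by `f` and the `x_i ^ q`, `q = p ^ n`. -/
noncomputable def e {p s : ℕ} (f : MvPolynomial (Fin s) (ZMod p)) (n : ℕ) : ℕ :=
  colength (powIdeal f fun _ => p ^ n)

/-- The Hilbert-Kunz multiplicity of `f`: the limit of `e_n(f) / q ^ (s - 1)`, `q = p ^ n`, as
`n → ∞`. -/
noncomputable def multiplicity {p s : ℕ} (f : MvPolynomial (Fin s) (ZMod p)) : ℝ :=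
  limUnder atTop fun n : ℕ => (e f n : ℝ) / ((p : ℝ) ^ n) ^ (s - 1)

end HilbertKunz

/-!
Substituting `x_i ^ d_i` for `x_i` makes the polynomial ring free of rank `d = ∏ d_i` over itself,
so the ideal `(h, x_i ^ (d_i κ_i))` has colength `d * D_p(κ)`, and `e_n` is sandwiched between two
such numbers with `κ_i` near `q / d_i`. Two facts control `D_p`. Changing each `κ_i ≤ M` by at most
`t` changes it by at most `s * t * M ^ (s - 2)`, since raising one exponent by `t` costs at most
`t` times the product of any `s - 2` others, `∑ x_i = 0` having eliminated one variable. And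
`D_p(p κ) = p ^ (s - 1) * D_p(κ)`, since Frobenius is free of rank `p ^ (s - 1)` on the remaining
variables. Together they bound the distance from `e_m / p ^ (m (s - 1))` to
`d * D_p(κ) / p ^ (n (s - 1))` by a constant over `p ^ n`, uniformly in `m ≥ n` and `p`, whenever
each `κ_i` is within a fixed distance of `p ^ n / d_i`. Taking `κ_i = ⌊p ^ n / d_i⌋` shows that the
limit exists, with the stated error term; taking `n = 1` and `κ = a` compares it with
`d * p ^ (1 - s) * D_p(a)`.
-/

namespace HilbertKunz

section Length

variable {k A B C M ι : Type*}

theorem length_restrictScalars_eq [CommRing k] [CommRing A] [Algebra k A] [AddCommGroup M]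
    [Module A M] [kM : Module k M] [IsScalarTower k A M]
    (h : ∀ m : Ideal A, m.IsMaximal → Module.annihilator A M ≤ m →
      Function.Surjective (algebraMap k (A ⧸ m))) :
    Module.length k M = Module.length A M := by
  by_cases hM : IsFiniteLength A M
  · revert kM
    induction hM with
    | of_subsingleton => intros; rw [Module.length_eq_zero, Module.length_eq_zero]
    | @of_simple_quotient M _ _ N hN _ ih =>
      intro _ _
      have hquot : Module.length k (M ⧸ N) = Module.length A (M ⧸ N) := by
        obtain ⟨m, hm, ⟨e⟩⟩ := isSimpleModule_iff_quot_maximal.1 hN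
        have hann : Module.annihilator A M ≤ m := by
          rw [← Ideal.annihilator_quotient (I := m), ← e.annihilator_eq]
          exact LinearMap.annihilator_le_of_surjective _ N.mkQ_surjective
        rw [(e.restrictScalars k).length_eq, e.length_eq,
          Module.length_eq_of_surjective (h m hm hann),
          Module.length_eq_of_surjective (S := A) (R := A ⧸ m) Ideal.Quotient.mk_surjective]
      have hsub : Module.length k N = Module.length A N := ih fun m hm hann =>
        h m hm ((LinearMap.annihilator_le_of_injective _ N.injective_subtype).trans hann)
      have hexact := LinearMap.exact_subtype_mkQ N
      rw [Module.length_eq_add_of_exact _ _ N.injective_subtype N.mkQ_surjective hexact,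
        Module.length_eq_add_of_exact (N.subtype.restrictScalars k) (N.mkQ.restrictScalars k)
          N.injective_subtype N.mkQ_surjective hexact, hsub, hquot]
  · have hle := Submodule.length_le_length_restrictScalars k (⊤ : Submodule A M)
    rw [← Module.length_ne_top_iff, not_ne_iff] at hM
    rw [Submodule.restrictScalars_top, Module.length_top, Module.length_top, hM] at hle
    rw [hM, top_le_iff.1 hle]

theorem length_quotient_map_of_bijective_sum [CommRing k] [CommRing A] [CommRing B] [Algebra k A]
    [Algebra k B] [Fintype ι] {φ : A →ₐ[k] B} {b : ι → B}
    (hb : Function.Bijective fun g : ι → A => ∑ i, φ (g i) * b i) (J : Ideal A) :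
    Module.length k (B ⧸ J.map φ) = Fintype.card ι * Module.length k (A ⧸ J) := by
  classical
  algebraize [φ.toRingHom]
  let basis : (ι → A) ≃ₗ[A] B := .ofBijective (Fintype.linearCombination A b) hb
  have e : (B ⧸ J.map (algebraMap A B)) ≃ₗ[A] (ι → A ⧸ J) :=
    (Submodule.Quotient.restrictScalarsEquiv A (J.map (algebraMap A B))).symm ≪≫ₗ
      Submodule.quotEquivOfEq _ _ J.smul_top_eq_map.symm ≪≫ₗ
      (TensorProduct.quotTensorEquivQuotSMul B J).symm ≪≫ₗ
      TensorProduct.congr (.refl A (A ⧸ J)) basis.symm ≪≫ₗ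
      TensorProduct.piScalarRight A A (A ⧸ J) ι
  have := (e.restrictScalars k).length_eq
  rw [Module.length_pi, ENat.card_eq_coe_fintype_card] at this
  exact this

theorem length_quotient_anti [CommRing k] [CommRing A] [Algebra k A] {I J : Ideal A} (h : I ≤ J) :
    Module.length k (A ⧸ J) ≤ Module.length k (A ⧸ I) :=
  Module.length_le_of_surjective (Ideal.Quotient.factorₐ k h).toLinearMap
    (Ideal.Quotient.factor_surjective h)

theorem length_quotient_map_of_surjective [CommRing k] [CommRing A] [CommRing B] [Algebra k A]
    [Algebra k B] {φ : A →ₐ[k] B} (hφ : Function.Surjective φ) {I : Ideal A}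
    (hI : RingHom.ker φ ≤ I) : Module.length k (B ⧸ I.map φ) = Module.length k (A ⧸ I) := by
  have hcomap : (I.map φ).comap φ ≤ I := by
    rw [Ideal.comap_map_of_surjective' φ hφ]
    exact sup_le le_rfl hI
  let f : (A ⧸ I) →ₐ[k] B ⧸ I.map φ := Ideal.quotientMapₐ _ φ Ideal.le_comap_map
  have hf : Function.Bijective f := ⟨Ideal.quotientMap_injective' (H := Ideal.le_comap_map) hcomap,
    Ideal.quotientMap_surjective (H := Ideal.le_comap_map) hφ⟩
  exact (AlgEquiv.ofBijective f hf).toLinearEquiv.length_eq.symm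

theorem length_quotient_le_add [CommRing k] [CommRing A] [Algebra k A] {I J K : Ideal A} (f : A)
    (hK : ∀ x ∈ K, f * x ∈ I) (hJ : J ≤ I ⊔ Ideal.span {f}) :
    Module.length k (A ⧸ I) ≤ Module.length k (A ⧸ J) + Module.length k (A ⧸ K) := by
  let g : (A ⧸ K) →ₗ[A] (A ⧸ I) := Submodule.mapQ K I (LinearMap.mulLeft A f) hK
  let c : A →ₗ[A] (A ⧸ I) ⧸ g.range := g.range.mkQ ∘ₗ I.mkQ
  have hg : g (Submodule.Quotient.mk 1) = I.mkQ f := congrArg I.mkQ (mul_one f)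
  have hker : J ≤ LinearMap.ker c := by
    refine hJ.trans (sup_le (fun x hx => ?_) ((Ideal.span_singleton_le_iff_mem _).2 ?_))
    · rw [LinearMap.mem_ker, LinearMap.comp_apply, Submodule.mkQ_apply I,
        (Submodule.Quotient.mk_eq_zero I).2 hx, map_zero]
    · exact (Submodule.Quotient.mk_eq_zero _).2 ⟨_, hg⟩
  have hc : Function.Surjective (J.liftQ c hker) := by
    rw [← LinearMap.range_eq_top, Submodule.range_liftQ, LinearMap.range_eq_top]
    exact g.range.mkQ_surjective.comp I.mkQ_surjective
  rw [Module.length_eq_add_of_exact (g.range.subtype.restrictScalars k)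
    (g.range.mkQ.restrictScalars k) g.range.injective_subtype g.range.mkQ_surjective
    (LinearMap.exact_subtype_mkQ _), add_comm]
  exact add_le_add
    (Module.length_le_of_surjective ((J.liftQ c hker).restrictScalars k) hc)
    (Module.length_le_of_surjective (g.rangeRestrict.restrictScalars k) g.surjective_rangeRestrict)

theorem length_le_prod_of_adjoin_eq_top [Field k] [CommRing C] [Algebra k C] [Fintype ι]
    {c : ι → C} (hc : Algebra.adjoin k (Set.range c) = ⊤) {N : ι → ℕ} (h : ∀ j, c j ^ N j = 0) :
    Module.length k C ≤ ∏ j, (N j : ℕ∞) := by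
  classical
  let ψ : ((∀ j, Fin (N j)) → k) →ₗ[k] C :=
    Fintype.linearCombination k fun r => ∏ j, c j ^ (r j : ℕ)
  have hmonomial (u : ι →₀ ℕ) : ∏ j, c j ^ u j ∈ ψ.range := by
    by_cases hu : ∀ j, u j < N j
    · exact ⟨Pi.single (fun j => ⟨u j, hu j⟩) 1, by simp [ψ]⟩
    · obtain ⟨j, hj⟩ := not_forall.1 hu
      have hzero : c j ^ u j = 0 := pow_eq_zero_of_le (not_lt.1 hj) (h j)
      rw [Finset.prod_eq_zero (Finset.mem_univ j) hzero]
      exact zero_mem _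
  have hψ : ψ.range = ⊤ := by
    rw [eq_top_iff, ← Algebra.top_toSubmodule, ← hc, Algebra.adjoin_range_eq_range_aeval]
    rintro _ ⟨f, rfl⟩
    induction f using MvPolynomial.induction_on' with
    | monomial u a =>
      simpa [MvPolynomial.aeval_monomial, Algebra.smul_def, Finsupp.prod_fintype] using
        ψ.range.smul_mem a (hmonomial u)
    | add f g hf hg => simpa using add_mem hf hg
  refine (Module.length_le_of_surjective ψ (LinearMap.range_eq_top.1 hψ)).trans_eq ?_
  simp

end Length

section Substitution

open MvPolynomial

variable {k σ : Type*} [CommRing k]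

theorem surjective_algebraMap_quotient_of_X_mem {I : Ideal (MvPolynomial σ k)}
    (h : ∀ i, X i ∈ I) :
    Function.Surjective (algebraMap k (MvPolynomial σ k ⧸ I)) := by
  have hmk : Ideal.Quotient.mkₐ k I = (Algebra.ofId k _).comp (aeval (0 : σ → k)) := by
    ext i
    simpa using Ideal.Quotient.eq_zero_iff_mem.2 (h i)
  intro x
  obtain ⟨f, rfl⟩ := Ideal.Quotient.mkₐ_surjective k I x
  exact ⟨aeval 0 f, (DFunLike.congr_fun hmk f).symm⟩

/-- The substitution `X i ↦ X i ^ d i`. For positive `d i` it makes the polynomial ring a free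
module of rank `∏ i, d i` over itself. -/
noncomputable def substPow (k : Type*) [CommRing k] {σ : Type*} (d : σ → ℕ) :
    MvPolynomial σ k →ₐ[k] MvPolynomial σ k :=
  aeval fun i => X i ^ d i

@[simp]
theorem substPow_X (d : σ → ℕ) (i : σ) : substPow k d (X i) = X i ^ d i := aeval_X _ _

variable [Fintype σ]

/-- Coordinatewise division with remainder by `d`: the remainders and quotients of a multi-index
determine it. -/
noncomputable def modDivEquiv {d : σ → ℕ} (hd : ∀ i, 0 < d i) :
    (Σ _ : ∀ i, Fin (d i), σ →₀ ℕ) ≃ (σ →₀ ℕ) where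
  toFun x := Finsupp.equivFunOnFinite.symm fun i => d i * x.2 i + x.1 i
  invFun v := ⟨fun i => ⟨v i % d i, Nat.mod_lt _ (hd i)⟩,
    Finsupp.equivFunOnFinite.symm fun i => v i / d i⟩
  left_inv := by
    rintro ⟨r, u⟩
    refine Sigma.ext (funext fun i => ?_) (heq_of_eq (Finsupp.ext fun i => ?_))
    · simp [Nat.mod_eq_of_lt]
    · simp [Nat.mul_add_div (hd i)]
  right_inv v := by ext i; simp [Nat.div_add_mod]

theorem substPow_monomial_mul_prod {d : σ → ℕ} (hd : ∀ i, 0 < d i) (r : ∀ i, Fin (d i))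
    (u : σ →₀ ℕ) :
    substPow k d (monomial u 1) * ∏ i, X i ^ (r i : ℕ) = monomial (modDivEquiv hd ⟨r, u⟩) 1 := by
  simp [substPow, modDivEquiv, monomial_eq, Finsupp.prod_fintype, pow_add, pow_mul,
    Finset.prod_mul_distrib]

theorem bijective_sum_substPow_mul_prod [DecidableEq σ] {d : σ → ℕ} (hd : ∀ i, 0 < d i) :
    Function.Bijective fun g : (∀ i, Fin (d i)) → MvPolynomial σ k =>
      ∑ r, substPow k d (g r) * ∏ i, X i ^ (r i : ℕ) := by
  let Θ : ((∀ i, Fin (d i)) → MvPolynomial σ k) →ₗ[k] MvPolynomial σ k :=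
    ∑ r, LinearMap.mulRight k (∏ i, X i ^ (r i : ℕ)) ∘ₗ (substPow k d).toLinearMap ∘ₗ .proj r
  let basis := Pi.basis fun _ : ∀ i, Fin (d i) => basisMonomials σ k
  have hΘ : Θ = basis.equiv (basisMonomials σ k) (modDivEquiv hd) := by
    refine basis.ext fun ⟨r, u⟩ => ?_
    rw [LinearEquiv.coe_coe, Module.Basis.equiv_apply]
    simp only [basis, Pi.basis_apply, coe_basisMonomials, Θ, LinearMap.sum_apply]
    rw [Finset.sum_eq_single r (fun t _ ht => by simp [ht]) (by simp)]
    simpa using substPow_monomial_mul_prod hd r u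
  have hΘ_apply : ⇑Θ = fun g => ∑ r, substPow k d (g r) * ∏ i, X i ^ (r i : ℕ) := by
    ext1 g
    simp [Θ, LinearMap.sum_apply]
  rw [← hΘ_apply, hΘ]
  exact LinearEquiv.bijective _

theorem length_quotient_map_substPow {d : σ → ℕ} (hd : ∀ i, 0 < d i)
    (J : Ideal (MvPolynomial σ k)) :
    Module.length k (MvPolynomial σ k ⧸ J.map (substPow k d))
      = (∏ i, d i : ℕ) * Module.length k (MvPolynomial σ k ⧸ J) := by
  classical
  rw [length_quotient_map_of_bijective_sum (bijective_sum_substPow_mul_prod hd), Fintype.card_pi]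
  simp only [Fintype.card_fin]

end Substitution

section Elimination

open MvPolynomial

variable {k : Type*} [CommRing k] {m : ℕ}

/-- The map `k[x_0, …, x_m] → k[x_1, …, x_m]` eliminating `x_0` by means of `∑ x_i = 0`. -/
noncomputable def elimZero (k : Type*) [CommRing k] (m : ℕ) :
    MvPolynomial (Fin (m + 1)) k →ₐ[k] MvPolynomial (Fin m) k :=
  aeval (Fin.cons (-∑ j, X j) X)

@[simp]
theorem elimZero_X_zero : elimZero k m (X 0) = -∑ j, X j := by simp [elimZero]

@[simp]
theorem elimZero_X_succ (j : Fin m) : elimZero k m (X j.succ) = X j := by simp [elimZero]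

theorem elimZero_sum_X : elimZero k m (∑ j, X j) = 0 := by simp [Fin.sum_univ_succ]

theorem elimZero_surjective : Function.Surjective (elimZero k m) := by
  have hsection : (elimZero k m).comp (rename Fin.succ) = AlgHom.id k _ := by ext; simp
  exact fun f => ⟨rename Fin.succ f, DFunLike.congr_fun hsection f⟩

theorem ker_elimZero_le {I : Ideal (MvPolynomial (Fin (m + 1)) k)} (hI : ∑ j, X j ∈ I) :
    RingHom.ker (elimZero k m) ≤ I := by
  have hsum : Ideal.Quotient.mk I (X 0) = -∑ j : Fin m, Ideal.Quotient.mk I (X j.succ) := by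
    rw [← map_sum]
    refine eq_neg_of_add_eq_zero_left ?_
    rw [← map_add, ← Fin.sum_univ_succ]
    exact Ideal.Quotient.eq_zero_iff_mem.2 hI
  have hmk : Ideal.Quotient.mkₐ k I
      = (Ideal.Quotient.mkₐ k I).comp ((rename Fin.succ).comp (elimZero k m)) := by
    ext i
    cases i using Fin.cases with
    | zero => simp [hsum]
    | succ j => simp
  intro f (hf : elimZero k m f = 0)
  refine Ideal.Quotient.eq_zero_iff_mem.1 ((DFunLike.congr_fun hmk f).trans ?_)
  rw [AlgHom.comp_apply, AlgHom.comp_apply, hf, map_zero, map_zero]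

end Elimination

section Colength

open MvPolynomial

variable {p s : ℕ}

theorem mem_powIdeal (f : MvPolynomial (Fin s) (ZMod p)) (κ : Fin s → ℕ) : f ∈ powIdeal f κ :=
  Ideal.subset_span (Set.mem_insert _ _)

theorem X_pow_mem_powIdeal (f : MvPolynomial (Fin s) (ZMod p)) {κ : Fin s → ℕ} {i : Fin s} {n : ℕ}
    (h : κ i ≤ n) : X i ^ n ∈ powIdeal f κ :=
  Ideal.pow_mem_of_pow_mem _ (Ideal.subset_span (Set.mem_insert_of_mem _ ⟨i, rfl⟩)) h

theorem powIdeal_le {f : MvPolynomial (Fin s) (ZMod p)} {κ : Fin s → ℕ}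
    {I : Ideal (MvPolynomial (Fin s) (ZMod p))} (hf : f ∈ I) (h : ∀ i, X i ^ κ i ∈ I) :
    powIdeal f κ ≤ I := by
  refine Ideal.span_le.2 (Set.insert_subset hf ?_)
  rintro _ ⟨i, rfl⟩
  exact h i

theorem map_substPow_powIdeal (f : MvPolynomial (Fin s) (ZMod p)) (d κ : Fin s → ℕ) :
    (powIdeal f κ).map (substPow (ZMod p) d)
      = powIdeal (substPow (ZMod p) d f) fun i => d i * κ i := by
  rw [powIdeal, Ideal.map_span, Set.image_insert_eq, ← Set.range_comp]
  simp only [powIdeal, Function.comp_def, map_pow, substPow_X, pow_mul]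

variable [Fact p.Prime]

theorem colength_powIdeal (f : MvPolynomial (Fin s) (ZMod p)) (κ : Fin s → ℕ) :
    (colength (powIdeal f κ) : ℕ∞)
      = Module.length (ZMod p) (MvPolynomial (Fin s) (ZMod p) ⧸ powIdeal f κ) := by
  rw [colength, ENat.natCast_toNat (length_ne_top f κ)]
  refine (length_restrictScalars_eq fun m hm hann => ?_).symm
  rw [Ideal.annihilator_quotient] at hann
  exact surjective_algebraMap_quotient_of_X_mem fun i =>
    hm.isPrime.mem_of_pow_mem _ (hann (X_pow_mem_powIdeal f le_rfl))

theorem colength_powIdeal_mono (f : MvPolynomial (Fin s) (ZMod p)) {κ κ' : Fin s → ℕ}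
    (h : ∀ i, κ i ≤ κ' i) : colength (powIdeal f κ) ≤ colength (powIdeal f κ') := by
  rw [← ENat.natCast_le_natCast, colength_powIdeal, colength_powIdeal]
  exact length_quotient_anti (powIdeal_le (mem_powIdeal f κ) fun i => X_pow_mem_powIdeal f (h i))

theorem colength_diagonal {d : Fin s → ℕ} (hd : ∀ i, 0 < d i) (κ : Fin s → ℕ) :
    colength (powIdeal (diagonal p d) fun i => d i * κ i) = (∏ i, d i) * D p κ := by
  have h := length_quotient_map_substPow hd (powIdeal (p := p) (∑ i, X i) κ)
  rw [map_substPow_powIdeal, map_sum, ← colength_powIdeal, ← colength_powIdeal] at h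
  simp only [substPow_X] at h
  exact_mod_cast h

theorem colength_powIdeal_update_le (f : MvPolynomial (Fin s) (ZMod p)) (κ : Fin s → ℕ) (i : Fin s)
    (t : ℕ) :
    colength (powIdeal f (Function.update κ i (κ i + t)))
      ≤ colength (powIdeal f κ) + colength (powIdeal f (Function.update κ i t)) := by
  have hmul : powIdeal f (Function.update κ i t) ≤ Submodule.comap
      (LinearMap.mulLeft _ (X i ^ κ i)) (powIdeal f (Function.update κ i (κ i + t))) := by
    refine powIdeal_le (Ideal.mul_mem_left _ _ (mem_powIdeal _ _)) fun j => ?_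
    rcases eq_or_ne j i with rfl | hj
    · rw [Submodule.mem_comap, LinearMap.mulLeft_apply, ← pow_add]
      exact X_pow_mem_powIdeal _ (by simp)
    · exact Ideal.mul_mem_left _ _ (X_pow_mem_powIdeal _ (by simp [hj]))
  have hsup : powIdeal f κ
      ≤ powIdeal f (Function.update κ i (κ i + t)) ⊔ Ideal.span {X i ^ κ i} := by
    refine powIdeal_le (Ideal.mem_sup_left (mem_powIdeal _ _)) fun j => ?_
    rcases eq_or_ne j i with rfl | hj
    · exact Ideal.mem_sup_right (Ideal.mem_span_singleton_self _)
    · exact Ideal.mem_sup_left (X_pow_mem_powIdeal _ (by simp [hj]))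
  have h := length_quotient_le_add (k := ZMod p) (X i ^ κ i) hmul hsup
  simp only [← colength_powIdeal] at h
  exact_mod_cast h

theorem D_le_prod_erase (κ : Fin s → ℕ) (l : Fin s) : D p κ ≤ ∏ j ∈ Finset.univ.erase l, κ j := by
  let I := powIdeal (p := p) (∑ j, X j) κ
  let x (j : Fin s) := Ideal.Quotient.mkₐ (ZMod p) I (X j)
  have hsum : x l + ∑ j ∈ Finset.univ.erase l, x j = 0 := by
    rw [Finset.add_sum_erase _ _ (Finset.mem_univ l), ← map_sum]
    exact Ideal.Quotient.eq_zero_iff_mem.2 (mem_powIdeal _ _)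
  have hgen : Algebra.adjoin (ZMod p) (Set.range fun j : Finset.univ.erase l => x j) = ⊤ := by
    set S := Algebra.adjoin (ZMod p) (Set.range fun j : Finset.univ.erase l => x j)
    have hS : ∀ j ∈ Finset.univ.erase l, x j ∈ S :=
      fun j hj => Algebra.subset_adjoin ⟨⟨j, hj⟩, rfl⟩
    have hxl : x l ∈ S := eq_neg_of_add_eq_zero_left hsum ▸ neg_mem (sum_mem hS)
    rw [eq_top_iff, ← (Ideal.Quotient.mkₐ (ZMod p) I).range_eq_top.2
      (Ideal.Quotient.mkₐ_surjective _ I), ← Algebra.map_top, ← adjoin_range_X, AlgHom.map_adjoin,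
      Algebra.adjoin_le_iff]
    rintro _ ⟨_, ⟨j, rfl⟩, rfl⟩
    rcases eq_or_ne j l with rfl | hj
    · exact hxl
    · exact hS j (Finset.mem_erase.2 ⟨hj, Finset.mem_univ j⟩)
  have hpow (j : Fin s) : x j ^ κ j = 0 := by
    rw [← map_pow]
    exact Ideal.Quotient.eq_zero_iff_mem.2 (X_pow_mem_powIdeal _ le_rfl)
  have h := length_le_prod_of_adjoin_eq_top hgen (N := fun j => κ j) fun j => hpow j
  rw [← colength_powIdeal, Finset.prod_coe_sort (Finset.univ.erase l) fun j => (κ j : ℕ∞)] at h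
  exact_mod_cast h

theorem D_mono {κ κ' : Fin s → ℕ} (h : ∀ i, κ i ≤ κ' i) : D p κ ≤ D p κ' :=
  colength_powIdeal_mono _ h

theorem D_update_le (hs : 2 ≤ s) {κ : Fin s → ℕ} {i : Fin s} {M a t : ℕ} (hκ : ∀ j, κ j ≤ M)
    (ha : a ≤ κ i + t) : D p (Function.update κ i a) ≤ D p κ + t * M ^ (s - 2) := by
  have : Nontrivial (Fin s) := Fin.nontrivial_iff_two_le.2 hs
  obtain ⟨l, hl⟩ := exists_ne i
  have hcard : ((Finset.univ.erase l).erase i).card = s - 2 := by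
    simp [Finset.card_erase_of_mem, hl.symm, Nat.sub_sub]
  calc D p (Function.update κ i a) ≤ D p (Function.update κ i (κ i + t)) :=
        D_mono (update_le_update_iff.2 ⟨ha, fun _ _ => le_rfl⟩)
    _ ≤ D p κ + D p (Function.update κ i t) := colength_powIdeal_update_le _ κ i t
    _ ≤ D p κ + ∏ j ∈ Finset.univ.erase l, Function.update κ i t j :=
        Nat.add_le_add_left (D_le_prod_erase _ l) _
    _ = D p κ + t * ∏ j ∈ (Finset.univ.erase l).erase i, κ j := by
        rw [Finset.prod_update_of_mem (Finset.mem_erase.2 ⟨hl.symm, Finset.mem_univ i⟩),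
          Finset.sdiff_singleton_eq_erase]
    _ ≤ D p κ + t * M ^ (s - 2) := by
        rw [← hcard]
        gcongr
        exact Finset.prod_le_pow_card _ _ _ fun j _ => hκ j

theorem D_le_add (hs : 2 ≤ s) {κ κ' : Fin s → ℕ} {M t : ℕ} (hκ : ∀ i, κ i ≤ M)
    (hκ' : ∀ i, κ' i ≤ M) (h : ∀ i, κ' i ≤ κ i + t) :
    D p κ' ≤ D p κ + s * t * M ^ (s - 2) := by
  have hpiecewise (S : Finset (Fin s)) :
      D p (S.piecewise κ' κ) ≤ D p κ + S.card * (t * M ^ (s - 2)) := by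
    induction S using Finset.induction_on with
    | empty => simp
    | insert i S hi ih =>
      have hM (j : Fin s) : S.piecewise κ' κ j ≤ M :=
        S.piecewise_cases κ' κ (· ≤ M) (hκ' j) (hκ j)
      have hstep : κ' i ≤ S.piecewise κ' κ i + t := by
        rw [S.piecewise_eq_of_notMem _ _ hi]
        exact h i
      rw [S.piecewise_insert, Finset.card_insert_of_notMem hi, add_one_mul, ← add_assoc]
      exact (D_update_le hs hM hstep).trans (Nat.add_le_add_right ih _)
  simpa [mul_assoc] using hpiecewise Finset.univ

theorem D_eq_length_elimZero {m : ℕ} (κ : Fin (m + 1) → ℕ) :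
    (D p κ : ℕ∞) = Module.length (ZMod p) (MvPolynomial (Fin m) (ZMod p) ⧸
      Ideal.span (Set.range fun i => elimZero (ZMod p) m (X i) ^ κ i)) := by
  have hmap : (powIdeal (p := p) (∑ j, X j) κ).map (elimZero (ZMod p) m)
      = Ideal.span (Set.range fun i => elimZero (ZMod p) m (X i) ^ κ i) := by
    rw [powIdeal, Ideal.map_span, Set.image_insert_eq, elimZero_sum_X, Ideal.span_insert_zero,
      ← Set.range_comp]
    simp only [Function.comp_def, map_pow]
  rw [D, colength_powIdeal, ← hmap, length_quotient_map_of_surjective elimZero_surjective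
    (ker_elimZero_le (mem_powIdeal _ _))]

/-- After eliminating one variable, passing from `κ` to `p κ` is the base change along Frobenius,
which is free of rank `p ^ (s - 1)`. -/
theorem D_prime_mul (hs : 0 < s) (κ : Fin s → ℕ) :
    D p (fun i => p * κ i) = p ^ (s - 1) * D p κ := by
  obtain ⟨m, rfl⟩ := Nat.exists_eq_add_of_le' hs
  have hfrob (f : MvPolynomial (Fin m) (ZMod p)) : substPow (ZMod p) (fun _ => p) f = f ^ p :=
    expand_zmod f
  have hmap : (Ideal.span (Set.range fun i => elimZero (ZMod p) m (X i) ^ κ i)).map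
      (substPow (ZMod p) fun _ => p)
      = Ideal.span (Set.range fun i => elimZero (ZMod p) m (X i) ^ (p * κ i)) := by
    rw [Ideal.map_span, ← Set.range_comp]
    simp only [Function.comp_def, hfrob, pow_mul']
  have h := length_quotient_map_substPow (fun _ : Fin m => (Fact.out : p.Prime).pos)
    (Ideal.span (Set.range fun i => elimZero (ZMod p) m (X i) ^ κ i))
  rw [hmap, ← D_eq_length_elimZero, ← D_eq_length_elimZero, Finset.prod_const, Finset.card_univ,
    Fintype.card_fin] at h
  exact_mod_cast h

theorem D_prime_pow_mul (hs : 0 < s) (κ : Fin s → ℕ) (j : ℕ) :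
    D p (fun i => p ^ j * κ i) = (p ^ j) ^ (s - 1) * D p κ := by
  induction j with
  | zero => simp
  | succ j ih => simp only [pow_succ' p, mul_assoc, D_prime_mul hs, ih, mul_pow]

end Colength

section Asymptotics

variable {p s : ℕ} [Fact p.Prime] {d : Fin s → ℕ}

theorem e_diagonal_le (hs : 2 ≤ s) (hd : ∀ i, 0 < d i) {κ : Fin s → ℕ} {n t M : ℕ}
    (hq : ∀ i, p ^ n ≤ d i * (κ i + t)) (hM : ∀ i, κ i + t ≤ M) :
    e (diagonal p d) n ≤ (∏ i, d i) * (D p κ + s * t * M ^ (s - 2)) := by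
  refine (colength_powIdeal_mono _ hq).trans ?_
  rw [colength_diagonal hd fun i => κ i + t]
  exact Nat.mul_le_mul_left _
    (D_le_add hs (fun i => le_of_add_le_left (hM i)) hM fun _ => le_rfl)

theorem le_e_diagonal (hs : 2 ≤ s) (hd : ∀ i, 0 < d i) {κ : Fin s → ℕ} {n t M : ℕ}
    (hq : ∀ i, d i * κ i ≤ p ^ n + d i * t) (hM : ∀ i, κ i ≤ M) :
    (∏ i, d i) * D p κ ≤ e (diagonal p d) n + (∏ i, d i) * (s * t * M ^ (s - 2)) := by
  have hD : D p κ ≤ D p (fun i => κ i - t) + s * t * M ^ (s - 2) :=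
    D_le_add hs (fun i => (Nat.sub_le _ _).trans (hM i)) hM fun i => Nat.le_add_of_sub_le le_rfl
  have he : (∏ i, d i) * D p (fun i => κ i - t) ≤ e (diagonal p d) n := by
    rw [← colength_diagonal hd]
    refine colength_powIdeal_mono _ fun i => ?_
    rw [Nat.mul_sub]
    exact Nat.sub_le_of_le_add (hq i)
  calc (∏ i, d i) * D p κ
    _ ≤ (∏ i, d i) * (D p (fun i => κ i - t) + s * t * M ^ (s - 2)) := Nat.mul_le_mul_left _ hD
    _ ≤ e (diagonal p d) n + (∏ i, d i) * (s * t * M ^ (s - 2)) := by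
        rw [mul_add]
        exact Nat.add_le_add_right he _

theorem abs_e_diagonal_sub_le (hs : 2 ≤ s) (hd : ∀ i, 0 < d i) {κ : Fin s → ℕ} {n t M : ℕ}
    (hle : ∀ i, d i * κ i ≤ p ^ n + d i * t) (hge : ∀ i, p ^ n ≤ d i * (κ i + t))
    (hM : ∀ i, κ i + t ≤ M) :
    |(e (diagonal p d) n : ℝ) - (∏ i, (d i : ℝ)) * D p κ|
      ≤ (∏ i, (d i : ℝ)) * (s * t * M ^ (s - 2)) := by
  have hupper := e_diagonal_le hs hd hge hM
  have hlower := le_e_diagonal hs hd hle fun i => le_of_add_le_left (hM i)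
  rw [mul_add] at hupper
  rw [abs_sub_le_iff, sub_le_iff_le_add', sub_le_iff_le_add']
  exact_mod_cast And.intro hupper hlower

theorem abs_e_diagonal_sub_prime_pow_mul_le (hs : 2 ≤ s) (hd : ∀ i, 0 < d i) {κ : Fin s → ℕ}
    {n N : ℕ} (j : ℕ) (hle : ∀ i, d i * κ i ≤ p ^ n + d i * N)
    (hge : ∀ i, p ^ n ≤ d i * (κ i + N)) :
    |(e (diagonal p d) (n + j) : ℝ) - (∏ i, (d i : ℝ)) * (((p : ℝ) ^ j) ^ (s - 1) * D p κ)|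
      ≤ (∏ i, (d i : ℝ)) * (s * (p ^ j * N) * (p ^ n * p ^ j * (1 + 2 * N)) ^ (s - 2)) := by
  have hM (i) : p ^ j * κ i + p ^ j * N ≤ p ^ n * p ^ j * (1 + 2 * N) := by
    have hκ : κ i ≤ p ^ n + N := by
      refine Nat.le_of_mul_le_mul_left ((hle i).trans ?_) (hd i)
      rw [mul_add]
      exact Nat.add_le_add_right (Nat.le_mul_of_pos_left _ (hd i)) _
    have hq : 1 ≤ p ^ n := Nat.one_le_pow _ _ (Fact.out : p.Prime).pos
    calc p ^ j * κ i + p ^ j * N = p ^ j * (κ i + N) := by ring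
      _ ≤ p ^ j * (p ^ n * (1 + 2 * N)) := Nat.mul_le_mul_left _ (by nlinarith)
      _ = p ^ n * p ^ j * (1 + 2 * N) := by ring
  have h := abs_e_diagonal_sub_le (p := p) hs hd (κ := fun i => p ^ j * κ i) (n := n + j)
    (t := p ^ j * N) (fun i => by linear_combination p ^ j * hle i)
    (fun i => by linear_combination p ^ j * hge i) hM
  rw [D_prime_pow_mul (by lia)] at h
  exact_mod_cast h

/-- The constant in the estimate for `e_m / q ^ (s - 1)`, `q = p ^ m`, in terms of `D_p(κ)` for a
tuple `κ` within `N` of `p ^ n / d`. -/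
noncomputable def errorConst (d : Fin s → ℕ) (N : ℕ) : ℝ :=
  (∏ i, (d i : ℝ)) * s * N * (1 + 2 * N) ^ (s - 2)

theorem abs_e_diagonal_div_sub_le (hs : 2 ≤ s) (hd : ∀ i, 0 < d i) {κ : Fin s → ℕ} {n m N : ℕ}
    (hnm : n ≤ m) (hle : ∀ i, d i * κ i ≤ p ^ n + d i * N)
    (hge : ∀ i, p ^ n ≤ d i * (κ i + N)) :
    |(e (diagonal p d) m : ℝ) / ((p : ℝ) ^ m) ^ (s - 1)
        - (∏ i, (d i : ℝ)) * D p κ / ((p : ℝ) ^ n) ^ (s - 1)| ≤ errorConst d N / (p : ℝ) ^ n := by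
  obtain ⟨j, rfl⟩ := Nat.exists_eq_add_of_le hnm
  have h := abs_e_diagonal_sub_prime_pow_mul_le hs hd j hle hge
  have hp : (0 : ℝ) < p := by exact_mod_cast (Fact.out : p.Prime).pos
  have hQ : (0 : ℝ) < (p : ℝ) ^ n := by positivity
  have hR : (0 : ℝ) < (p : ℝ) ^ j := by positivity
  rw [pow_add (p : ℝ), errorConst]
  generalize (p : ℝ) ^ n = Q at *
  generalize (p : ℝ) ^ j = R at *
  generalize (e (diagonal p d) (n + j) : ℝ) = E at *
  calc |E / (Q * R) ^ (s - 1) - (∏ i, (d i : ℝ)) * D p κ / Q ^ (s - 1)|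
    _ = |E - (∏ i, (d i : ℝ)) * (R ^ (s - 1) * D p κ)| / (Q * R) ^ (s - 1) := by
        rw [← abs_of_pos (a := (Q * R) ^ (s - 1)) (by positivity), ← abs_div,
          abs_of_pos (a := (Q * R) ^ (s - 1)) (by positivity), mul_pow]
        congr 1
        field_simp
    _ ≤ (∏ i, (d i : ℝ)) * (s * (R * N) * (Q * R * (1 + 2 * N)) ^ (s - 2))
          / (Q * R) ^ (s - 1) := by gcongr
    _ = (∏ i, (d i : ℝ)) * s * N * (1 + 2 * N) ^ (s - 2) / Q := by
        rw [show s - 1 = s - 2 + 1 by lia, mul_pow (Q * R), pow_succ]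
        field_simp

theorem dist_e_diagonal_div_le (hs : 2 ≤ s) (hd : ∀ i, 0 < d i) {n m l : ℕ} (hm : n ≤ m)
    (hl : n ≤ l) :
    dist ((e (diagonal p d) m : ℝ) / ((p : ℝ) ^ m) ^ (s - 1))
        ((e (diagonal p d) l : ℝ) / ((p : ℝ) ^ l) ^ (s - 1))
      ≤ 2 * errorConst d 1 / (p : ℝ) ^ n := by
  have hfloor {m : ℕ} (hm : n ≤ m) := abs_e_diagonal_div_sub_le (p := p) hs hd
    (κ := fun i => p ^ n / d i) (N := 1) hm
    (fun i => (Nat.mul_div_le _ _).trans (Nat.le_add_right _ _))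
    (fun i => (Nat.lt_mul_div_succ _ (hd i)).le)
  rw [mul_div_assoc, two_mul]
  exact (dist_triangle_right _ _ _).trans (add_le_add (hfloor hm) (hfloor hl))

theorem tendsto_e_diagonal_div (hs : 2 ≤ s) (hd : ∀ i, 0 < d i) :
    Tendsto (fun n : ℕ => (e (diagonal p d) n : ℝ) / ((p : ℝ) ^ n) ^ (s - 1)) atTop
      (𝓝 (multiplicity (diagonal p d))) := by
  have hp : 1 < (p : ℝ) := by exact_mod_cast (Fact.out : p.Prime).one_lt
  have hcauchy : CauchySeq fun n : ℕ => (e (diagonal p d) n : ℝ) / ((p : ℝ) ^ n) ^ (s - 1) :=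
    cauchySeq_of_le_tendsto_0 _ (fun _ _ _ => dist_e_diagonal_div_le hs hd)
      (tendsto_const_nhds.div_atTop (tendsto_pow_atTop_atTop_of_one_lt hp))
  exact hcauchy.tendsto_limUnder

theorem e_diagonal_sub_isBigO (hs : 2 ≤ s) (hd : ∀ i, 0 < d i) :
    (fun n : ℕ => (e (diagonal p d) n : ℝ)
        - multiplicity (diagonal p d) * ((p : ℝ) ^ n) ^ (s - 1))
      =O[atTop] fun n : ℕ => ((p : ℝ) ^ n) ^ (s - 2) := by
  refine IsBigO.of_bound (2 * errorConst d 1) (Eventually.of_forall fun n => ?_)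
  have hlim : dist ((e (diagonal p d) n : ℝ) / ((p : ℝ) ^ n) ^ (s - 1))
      (multiplicity (diagonal p d)) ≤ 2 * errorConst d 1 / (p : ℝ) ^ n :=
    le_of_tendsto (tendsto_const_nhds.dist (tendsto_e_diagonal_div hs hd))
      ((eventually_ge_atTop n).mono fun m hm => dist_e_diagonal_div_le hs hd le_rfl hm)
  have hQ : (0 : ℝ) < (p : ℝ) ^ n := pow_pos (by exact_mod_cast (Fact.out : p.Prime).pos) n
  have hpow : ((p : ℝ) ^ n) ^ (s - 1) = ((p : ℝ) ^ n) ^ (s - 2) * (p : ℝ) ^ n := by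
    rw [← pow_succ]
    congr 1
    lia
  rw [Real.dist_eq, div_sub' (by positivity), abs_div, abs_of_pos (pow_pos hQ _),
    div_le_div_iff₀ (by positivity) hQ, hpow, ← mul_assoc, mul_le_mul_iff_left₀ hQ] at hlim
  rw [Real.norm_eq_abs, Real.norm_of_nonneg (by positivity), hpow, mul_comm (multiplicity _)]
  exact hlim

theorem mul_le_and_le_mul_of_abs_sub_div_le {a d q N : ℕ} (hd : 0 < d)
    (h : |(a : ℝ) - (q : ℝ) / d| ≤ N) : d * a ≤ q + d * N ∧ q ≤ d * (a + N) := by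
  have hd' : (0 : ℝ) < d := by exact_mod_cast hd
  rw [sub_div' hd'.ne', abs_div, abs_of_pos hd', div_le_iff₀ hd', abs_sub_le_iff] at h
  constructor
  · have : (d * a : ℝ) ≤ q + d * N := by linarith
    exact_mod_cast this
  · have : (q : ℝ) ≤ d * (a + N) := by linarith
    exact_mod_cast this

theorem abs_multiplicity_diagonal_sub_le (hs : 2 ≤ s) (hd : ∀ i, 0 < d i) {a : Fin s → ℕ} {N : ℕ}
    (ha : ∀ i, |(a i : ℝ) - (p : ℝ) / d i| ≤ N) :
    |multiplicity (diagonal p d) - (∏ i, (d i : ℝ)) * (p : ℝ) ^ (1 - (s : ℤ)) * D p a|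
      ≤ errorConst d N / p := by
  have hbounds (i) := mul_le_and_le_mul_of_abs_sub_div_le (hd i) (ha i)
  have hlim := le_of_tendsto (((tendsto_e_diagonal_div (p := p) hs hd).sub_const
      ((∏ i, (d i : ℝ)) * D p a / ((p : ℝ) ^ 1) ^ (s - 1))).abs)
    ((eventually_ge_atTop 1).mono fun m hm => abs_e_diagonal_div_sub_le hs hd hm
      (fun i => (pow_one p).symm ▸ (hbounds i).1) fun i => (pow_one p).symm ▸ (hbounds i).2)
  have hzpow : (p : ℝ) ^ (1 - (s : ℤ)) = ((p : ℝ) ^ (s - 1))⁻¹ := by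
    rw [← zpow_natCast, ← zpow_neg]
    congr 1
    lia
  rwa [pow_one, div_eq_mul_inv _ (_ ^ _), ← hzpow, mul_right_comm] at hlim

end Asymptotics

end HilbertKunz

theorem theorem1p5 (s : ℕ) (hs : 2 ≤ s) (d : Fin s → ℕ) (hd : ∀ i, 1 < d i)
    (a : ℕ → Fin s → ℕ)
    (ha : ∃ C : ℝ, ∀ p : ℕ, p.Prime → ∀ i, |(a p i : ℝ) - (p : ℝ) / (d i : ℝ)| ≤ C) :
    -- the limit `μ` exists, with `e_n = μ q ^ (s - 1) + O(q ^ (s - 2))` for each fixed `p`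
    (∀ p : ℕ, p.Prime →
      (fun n : ℕ => (HilbertKunz.e (HilbertKunz.diagonal p d) n : ℝ)
          - HilbertKunz.multiplicity (HilbertKunz.diagonal p d) * ((p : ℝ) ^ n) ^ (s - 1))
        =O[atTop] fun n : ℕ => ((p : ℝ) ^ n) ^ (s - 2)) ∧
    ∃ k : ℝ, ∀ p : ℕ, p.Prime →
      |HilbertKunz.multiplicity (HilbertKunz.diagonal p d)
        - (∏ i, (d i : ℝ)) * (p : ℝ) ^ (1 - (s : ℤ)) * (HilbertKunz.D p (a p) : ℝ)|
          ≤ k / (p : ℝ) := by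
  have hd' : ∀ i, 0 < d i := fun i => Nat.zero_lt_of_lt (hd i)
  obtain ⟨C, hC⟩ := ha
  obtain ⟨N, hN⟩ := exists_nat_ge C
  refine ⟨fun p hp => ?_, HilbertKunz.errorConst d N, fun p hp => ?_⟩
  · have : Fact p.Prime := ⟨hp⟩
    exact HilbertKunz.e_diagonal_sub_isBigO hs hd'
  · have : Fact p.Prime := ⟨hp⟩
    exact HilbertKunz.abs_multiplicity_diagonal_sub_le hs hd' fun i => (hC p hp i).trans hN
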